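/- Let $p,\tilde p:[0,1]\to\mathbb R$ be piecewise continuous (continuous at all but finitely many points, with finite one-sided limits everywhere) and bounded below by a positive constant. Let $\alpha\in(0,\pi]$, $\beta\in[0,\pi)$, and assume that $\cos\alpha\cos\beta-\sin(\alpha-\beta)\neq 0$ whenever $(\alpha,\beta)\in[\pi/4,\pi]\times[0,3\pi/4]$. Let $\lambda_0$ be the lowest eigenvalue of the problem $$-u''=\lambda\, p(x)\,u\ \text{ on }(0,1),\qquad u(0)\cos\alpha+u'(0)\sin\alpha=0,\qquad u(1)\cos\beta+u'(1)\sin\beta=0,$$ where solutions are $C^1$ on $[0,1]$ and satisfy the equation at all but finitely many points, and let $\tilde\lambda_0$ be the lowest eigenvalue of the same problem with $\tilde p$ in place of $p$. If $$\lambda_0=\tilde\lambda_0\,\sup_{x\in[0,1]}\frac{\tilde p(x)}{p(x)}\qquad\text{or}\qquad \lambda_0=\tilde\lambda_0\,\inf_{x\in[0,1]}\frac{\tilde p(x)}{p(x)}$$ (in particular if this holds with a maximum or minimum that is attained), then $$p(x)=\frac{\tilde\lambda_0}{\lambda_0}\,\tilde p(x)$$ for all but finitely many $x\in[0,1]$,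 and more precisely at every $x\in[0,1]$ at which $p$ and $\tilde p$ are both right-continuous (with $x<1$) or both left-continuous (with $x>0$). In particular the equality holds on all of $[0,1]$ if $p$ and $\tilde p$ are continuous. -/

import Mathlib

open Set Filter Topology

namespace VibratingString

/-- Piecewise continuity on `[0,1]`: continuous at all but finitely many points of `[0,1]`,
with finite one-sided limits at every point of `[0,1]` (from inside the interval). -/
def PiecewiseContinuous (p : ℝ → ℝ) : Prop :=
  (∃ F : Finset ℝ, ∀ x ∈ Icc (0 : ℝ) 1, x ∉ F → ContinuousWithinAt p (Icc 0 1) x) ∧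
  (∀ x ∈ Ico (0 : ℝ) 1, ∃ l : ℝ, Tendsto p (𝓝[>] x) (𝓝 l)) ∧
  (∀ x ∈ Ioc (0 : ℝ) 1, ∃ l : ℝ, Tendsto p (𝓝[<] x) (𝓝 l))

/-- Density of a string on `[0,1]`: piecewise continuous, positive and bounded away from `0`. -/
structure IsDensity (p : ℝ → ℝ) : Prop where
  piecewiseContinuous : PiecewiseContinuous p
  boundedAway : ∃ c : ℝ, 0 < c ∧ ∀ x ∈ Icc (0 : ℝ) 1, c ≤ p x

/-- `u` solves `-u'' = z p u` on `(0,1)` and `v = u'`: `u` is continuously differentiable on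
`[0,1]` (one-sided derivatives at the end points), and the equation holds at all but finitely
many points, as `u''` need not exist at the jumps of `p`. -/
structure IsSolution (p : ℝ → ℝ) (z : ℂ) (u v : ℝ → ℂ) : Prop where
  hasDeriv : ∀ x ∈ Icc (0 : ℝ) 1, HasDerivWithinAt u (v x) (Icc 0 1) x
  continuousOn_deriv : ContinuousOn v (Icc 0 1)
  equation : ∃ F : Finset ℝ, ∀ x ∈ Ioo (0 : ℝ) 1, x ∉ F →
    ∃ w : ℂ, HasDerivAt v w x ∧ -w = z * (p x : ℂ) * u x

/-- `z` is an eigenvalue of the string problem `-u'' = z p u` with boundary conditions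
`u(0) cos α + u'(0) sin α = 0` and `u(1) cos β + u'(1) sin β = 0`. -/
def IsEigenvalue (p : ℝ → ℝ) (α β : ℝ) (z : ℂ) : Prop :=
  ∃ u v : ℝ → ℂ, IsSolution p z u v ∧
    u 0 * (Real.cos α : ℂ) + v 0 * (Real.sin α : ℂ) = 0 ∧
    u 1 * (Real.cos β : ℂ) + v 1 * (Real.sin β : ℂ) = 0 ∧
    ∃ x ∈ Icc (0 : ℝ) 1, u x ≠ 0

/-- `l` is the lowest eigenvalue (all eigenvalues of the problem are real). -/
def IsLowestEigenvalue (p : ℝ → ℝ) (α β l : ℝ) : Prop :=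
  IsLeast {t : ℝ | IsEigenvalue p α β (t : ℂ)} l

/-- The two functions on `[0,1]` are both right-continuous at `x < 1`, or both left-continuous
at `x > 0`. -/
def ContinuousFromCommonSide (p q : ℝ → ℝ) (x : ℝ) : Prop :=
  (x < 1 ∧ ContinuousWithinAt p (Icc x 1) x ∧ ContinuousWithinAt q (Icc x 1) x) ∨
  (0 < x ∧ ContinuousWithinAt p (Icc 0 x) x ∧ ContinuousWithinAt q (Icc 0 x) x)

end VibratingString

namespace VibratingString

/-- A continuous function on `[a,b]` whose derivative is nonnegative off a finite set is monotone. -/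
theorem monotoneOn_of_hasDerivAt_nonneg_off_finset {f f' : ℝ → ℝ} (F : Finset ℝ) :
    ∀ a b : ℝ, ContinuousOn f (Icc a b) →
      (∀ x ∈ Ioo a b, x ∉ F → HasDerivAt f (f' x) x) →
      (∀ x ∈ Ioo a b, x ∉ F → 0 ≤ f' x) → MonotoneOn f (Icc a b) := by
  induction F using Finset.induction_on with
  | empty =>
    intro a b hf hd hn
    refine monotoneOn_of_hasDerivWithinAt_nonneg (f' := f') (convex_Icc a b) hf ?_ ?_
    · intro x hx
      rw [interior_Icc] at hx ⊢
      exact (hd x hx (by simp)).hasDerivWithinAt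
    · intro x hx
      rw [interior_Icc] at hx
      exact hn x hx (by simp)
  | insert c F _ ih =>
    intro a b hf hd hn
    by_cases hc : c ∈ Ioo a b
    · have h1 : MonotoneOn f (Icc a c) := by
        refine ih a c (hf.mono (Icc_subset_Icc_right hc.2.le)) ?_ ?_
        · intro x hx hxF
          exact hd x ⟨hx.1, hx.2.trans hc.2⟩ (by simp [hx.2.ne, hxF])
        · intro x hx hxF
          exact hn x ⟨hx.1, hx.2.trans hc.2⟩ (by simp [hx.2.ne, hxF])
      have h2 : MonotoneOn f (Icc c b) := by
        refine ih c b (hf.mono (Icc_subset_Icc_left hc.1.le)) ?_ ?_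
        · intro x hx hxF
          exact hd x ⟨hc.1.trans hx.1, hx.2⟩ (by simp [hx.1.ne', hxF])
        · intro x hx hxF
          exact hn x ⟨hc.1.trans hx.1, hx.2⟩ (by simp [hx.1.ne', hxF])
      have h3 := h1.union_right h2 (isGreatest_Icc hc.1.le) (isLeast_Icc hc.2.le)
      rwa [Icc_union_Icc_eq_Icc hc.1.le hc.2.le] at h3
    · have key : ∀ x ∈ Ioo a b, x ∉ F → x ∉ insert c F := by
        intro x hx hxF
        simp only [Finset.mem_insert, not_or]
        exact ⟨fun h => hc (h ▸ hx), hxF⟩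
      exact ih a b hf (fun x hx hxF => hd x hx (key x hx hxF))
        (fun x hx hxF => hn x hx (key x hx hxF))

/-- `u` is a real solution of `u'' = -P u` on `[0,1]` off a finite set, and `v = u'`. -/
structure IsRealSolution (P u v : ℝ → ℝ) : Prop where
  hasDeriv : ∀ x ∈ Icc (0 : ℝ) 1, HasDerivWithinAt u (v x) (Icc 0 1) x
  continuousOn_deriv : ContinuousOn v (Icc 0 1)
  equation : ∃ F : Finset ℝ, ∀ x ∈ Ioo (0 : ℝ) 1, x ∉ F → HasDerivAt v (-(P x * u x)) x

namespace IsRealSolution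

variable {P Q u v a b : ℝ → ℝ}

theorem continuousOn (h : IsRealSolution P u v) : ContinuousOn u (Icc 0 1) :=
  fun x hx => (h.hasDeriv x hx).continuousWithinAt

theorem hasDerivAt (h : IsRealSolution P u v) {x : ℝ} (hx : x ∈ Ioo (0 : ℝ) 1) :
    HasDerivAt u (v x) x :=
  (h.hasDeriv x (Ioo_subset_Icc_self hx)).hasDerivAt (Icc_mem_nhds hx.1 hx.2)

theorem continuousOn_wronskian (h : IsRealSolution P u v) (k : IsRealSolution Q a b) :
    ContinuousOn (fun x => u x * b x - v x * a x) (Icc 0 1) :=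
  (h.continuousOn.mul k.continuousOn_deriv).sub (h.continuousOn_deriv.mul k.continuousOn)

theorem hasDerivAt_wronskian (h : IsRealSolution P u v) (k : IsRealSolution Q a b) :
    ∃ F : Finset ℝ, ∀ x ∈ Ioo (0 : ℝ) 1, x ∉ F →
      HasDerivAt (fun x => u x * b x - v x * a x) ((P x - Q x) * (u x * a x)) x := by
  obtain ⟨F, hF⟩ := h.equation
  obtain ⟨G, hG⟩ := k.equation
  refine ⟨F ∪ G, fun x hx hxF => ?_⟩
  simp only [Finset.mem_union, not_or] at hxF
  have := ((h.hasDerivAt hx).mul (hG x hx hxF.2)).sub ((hF x hx hxF.1).mul (k.hasDerivAt hx))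
  refine this.congr_deriv ?_
  ring

theorem monotoneOn_wronskian (h : IsRealSolution P u v) (k : IsRealSolution Q a b) {c : ℝ}
    (hc : c ≤ 1) (hs : ∀ x ∈ Ioo 0 c, 0 ≤ (P x - Q x) * (u x * a x)) :
    MonotoneOn (fun x => u x * b x - v x * a x) (Icc 0 c) := by
  obtain ⟨F, hF⟩ := h.hasDerivAt_wronskian k
  exact monotoneOn_of_hasDerivAt_nonneg_off_finset F 0 c
    ((h.continuousOn_wronskian k).mono (Icc_subset_Icc_right hc))
    (fun x hx hxF => hF x ⟨hx.1, hx.2.trans_le hc⟩ hxF) (fun x hx _ => hs x hx)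

theorem antitoneOn_wronskian (h : IsRealSolution P u v) (k : IsRealSolution Q a b) {c : ℝ}
    (hc : c ≤ 1) (hs : ∀ x ∈ Ioo 0 c, (P x - Q x) * (u x * a x) ≤ 0) :
    AntitoneOn (fun x => u x * b x - v x * a x) (Icc 0 c) := by
  have hm := k.monotoneOn_wronskian h hc
    (fun x hx => by have := hs x hx; linarith)
  intro x hx y hy hxy
  have := hm hx hy hxy
  simp only at this ⊢
  linarith

theorem wronskian_eq (h : IsRealSolution P u v) (k : IsRealSolution P a b) {x : ℝ}
    (hx : x ∈ Icc (0 : ℝ) 1) : u x * b x - v x * a x = u 0 * b 0 - v 0 * a 0 := by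
  have h0 : (0 : ℝ) ∈ Icc (0 : ℝ) 1 := ⟨le_rfl, zero_le_one⟩
  exact le_antisymm
    (h.antitoneOn_wronskian k le_rfl (fun x _ => by simp) h0 hx hx.1)
    (h.monotoneOn_wronskian k le_rfl (fun x _ => by simp) h0 hx hx.1)

/-- If two solutions with the same boundary behaviour are positive in the interior and the
coefficients are ordered, then the coefficients agree off a finite set. -/
theorem coeff_eq_off_finset (h : IsRealSolution P u v) (k : IsRealSolution Q a b)
    (hu : ∀ x ∈ Ioo (0 : ℝ) 1, 0 < u x) (ha : ∀ x ∈ Ioo (0 : ℝ) 1, 0 < a x)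
    (h0 : u 0 * b 0 - v 0 * a 0 = 0) (h1 : u 1 * b 1 - v 1 * a 1 = 0)
    (hPQ : (∀ x ∈ Icc (0 : ℝ) 1, Q x ≤ P x) ∨ (∀ x ∈ Icc (0 : ℝ) 1, P x ≤ Q x)) :
    ∃ F : Finset ℝ, ∀ x ∈ Icc (0 : ℝ) 1, x ∉ F → P x = Q x := by
  have m0 : (0 : ℝ) ∈ Icc (0 : ℝ) 1 := ⟨le_rfl, zero_le_one⟩
  have m1 : (1 : ℝ) ∈ Icc (0 : ℝ) 1 := ⟨zero_le_one, le_rfl⟩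
  have hW : ∀ x ∈ Icc (0 : ℝ) 1, u x * b x - v x * a x = 0 := by
    intro x hx
    rcases hPQ with hPQ | hPQ
    · have hm := h.monotoneOn_wronskian k le_rfl (fun y hy =>
        mul_nonneg (sub_nonneg.2 (hPQ y (Ioo_subset_Icc_self hy)))
          (mul_pos (hu y hy) (ha y hy)).le)
      have e0 := hm m0 hx hx.1
      have e1 := hm hx m1 hx.2
      simp only at e0 e1
      linarith
    · have hm := h.antitoneOn_wronskian k le_rfl (fun y hy =>
        mul_nonpos_of_nonpos_of_nonneg (sub_nonpos.2 (hPQ y (Ioo_subset_Icc_self hy)))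
          (mul_pos (hu y hy) (ha y hy)).le)
      have e0 := hm m0 hx hx.1
      have e1 := hm hx m1 hx.2
      simp only at e0 e1
      linarith
  obtain ⟨F, hF⟩ := h.hasDerivAt_wronskian k
  refine ⟨F ∪ {0, 1}, fun x hx hxF => ?_⟩
  simp only [Finset.mem_union, Finset.mem_insert, Finset.mem_singleton, not_or] at hxF
  have hx' : x ∈ Ioo (0 : ℝ) 1 :=
    ⟨lt_of_le_of_ne hx.1 (Ne.symm hxF.2.1), lt_of_le_of_ne hx.2 hxF.2.2⟩
  have hz : (fun x => u x * b x - v x * a x) =ᶠ[𝓝 x] fun _ => 0 := by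
    filter_upwards [Icc_mem_nhds hx'.1 hx'.2] with y hy using hW y hy
  have hd := (hF x hx' hxF.1).unique ((hasDerivAt_const x (0 : ℝ)).congr_of_eventuallyEq hz)
  rcases mul_eq_zero.1 hd with e | e
  · linarith
  · exact absurd e (mul_pos (hu x hx') (ha x hx')).ne'

end IsRealSolution

theorem PiecewiseContinuous.bounded {p : ℝ → ℝ} (hp : PiecewiseContinuous p) :
    ∃ K : ℝ, 0 ≤ K ∧ ∀ x ∈ Icc (0 : ℝ) 1, |p x| ≤ K := by
  suffices h : ∃ K : ℝ, ∀ x ∈ Icc (0 : ℝ) 1, |p x| ≤ K by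
    obtain ⟨K, hK⟩ := h
    exact ⟨K, (abs_nonneg _).trans (hK 0 ⟨le_rfl, zero_le_one⟩), hK⟩
  refine isCompact_Icc.induction_on (p := fun s => ∃ K : ℝ, ∀ x ∈ s, |p x| ≤ K) ⟨0, by simp⟩
    (fun s t hst ⟨K, hK⟩ => ⟨K, fun x hx => hK x (hst hx)⟩) ?_ ?_
  · rintro s t ⟨K, hK⟩ ⟨K', hK'⟩
    refine ⟨max K K', fun x hx => ?_⟩
    rcases hx with hx | hx
    · exact (hK x hx).trans (le_max_left _ _)
    · exact (hK' x hx).trans (le_max_right _ _)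
  · intro x hx
    have tail : ∀ {f : Filter ℝ} {l : ℝ}, Tendsto p f (𝓝 l) → ∀ᶠ y in f, |p y| ≤ |l| + 1 :=
      fun h => (h.abs.eventually (gt_mem_nhds (lt_add_one _))).mono fun y hy => hy.le
    have hl : ∃ K, ∀ᶠ y in 𝓝[<] x, y ∈ Icc (0 : ℝ) 1 → |p y| ≤ K := by
      rcases hx.1.eq_or_lt with h0 | h0
      · exact ⟨0, by filter_upwards [self_mem_nhdsWithin] with y hy hy'
          using absurd (h0 ▸ hy : y < 0) (not_lt.2 hy'.1)⟩
      · obtain ⟨l, hl⟩ := hp.2.2 x ⟨h0, hx.2⟩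
        exact ⟨_, (tail hl).mono fun y hy _ => hy⟩
    have hr : ∃ K, ∀ᶠ y in 𝓝[>] x, y ∈ Icc (0 : ℝ) 1 → |p y| ≤ K := by
      rcases hx.2.eq_or_lt with h0 | h0
      · exact ⟨0, by filter_upwards [self_mem_nhdsWithin] with y hy hy'
          using absurd (h0 ▸ hy : 1 < y) (not_lt.2 hy'.2)⟩
      · obtain ⟨l, hl⟩ := hp.2.1 x ⟨hx.1, h0⟩
        exact ⟨_, (tail hl).mono fun y hy _ => hy⟩
    obtain ⟨K, hK⟩ := hl
    obtain ⟨K', hK'⟩ := hr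
    rw [eventually_nhdsWithin_iff] at hK hK'
    refine ⟨{y | |p y| ≤ max |p x| (max K K')}, ?_, _, fun y hy => hy⟩
    rw [mem_nhdsWithin_iff_eventually]
    filter_upwards [hK, hK'] with y h1 h2 hy
    rcases lt_trichotomy y x with h | h | h
    · exact (h1 h hy).trans ((le_max_left _ _).trans (le_max_right _ _))
    · exact h ▸ le_max_left _ _
    · exact (h2 h hy).trans ((le_max_right _ _).trans (le_max_right _ _))

open MeasureTheory in
theorem PiecewiseContinuous.aestronglyMeasurable {p : ℝ → ℝ} (hp : PiecewiseContinuous p) :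
    AEStronglyMeasurable p (volume.restrict (Icc 0 1)) := by
  obtain ⟨F, hF⟩ := hp.1
  have hm : MeasurableSet (Icc (0 : ℝ) 1 \ F) := measurableSet_Icc.diff F.measurableSet
  have hc : ContinuousOn p (Icc (0 : ℝ) 1 \ F) := fun x hx =>
    (hF x hx.1 hx.2).mono sdiff_subset
  have := hc.aestronglyMeasurable (μ := volume) hm
  rwa [Measure.restrict_congr_set
    (sdiff_null_ae_eq_self (F.finite_toSet.measure_zero volume))] at this

section Neumann

variable {E : Type*} [NormedAddCommGroup E] [NormedSpace ℝ E] [CompleteSpace E]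

theorem isUnit_one_add_smul_of_norm_pow_le {T : E →L[ℝ] E} {K : ℝ}
    (hT : ∀ n : ℕ, ‖T ^ n‖ ≤ K ^ n / n.factorial) (z : ℝ) : IsUnit (1 + z • T) := by
  obtain ⟨n, hn⟩ : ∃ n : ℕ, (|z| * K) ^ n / n.factorial < 1 :=
    ((FloorSemiring.tendsto_pow_div_factorial_atTop (|z| * K)).eventually
      (gt_mem_nhds one_pos)).exists
  have hTn : ‖((-z) • T) ^ n‖ < 1 := by
    rw [smul_pow, norm_smul, norm_pow, norm_neg, Real.norm_eq_abs]
    refine lt_of_le_of_lt (mul_le_mul_of_nonneg_left (hT n) (by positivity)) ?_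
    rwa [← mul_div_assoc, ← mul_pow]
  have hu : IsUnit (1 - ((-z) • T) ^ n) := isUnit_one_sub_of_norm_lt_one hTn
  rw [← mul_neg_geom_sum] at hu
  have e : 1 + z • T = 1 - (-z) • T := by rw [neg_smul, sub_neg_eq_add]
  rw [e]
  refine ((Commute.isUnit_mul_iff ?_).1 hu).1
  exact (Commute.one_left _).sub_left
    (Commute.sum_right _ _ _ fun i _ => (Commute.refl _).pow_right i)

/-- The equation `s + z T s = φ` has a solution that depends continuously on `z`. -/
theorem exists_continuous_resolvent {T : E →L[ℝ] E} {K : ℝ}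
    (hT : ∀ n : ℕ, ‖T ^ n‖ ≤ K ^ n / n.factorial) (φ : E) :
    ∃ s : ℝ → E, Continuous s ∧ ∀ z, s z = φ - z • T (s z) := by
  refine ⟨fun z => Ring.inverse (1 + z • T) φ, ?_, fun z => ?_⟩
  · have : Continuous fun z : ℝ => Ring.inverse (1 + z • T) := by
      rw [continuous_iff_continuousAt]
      intro z
      obtain ⟨y, hy⟩ := isUnit_one_add_smul_of_norm_pow_le hT z
      have h1 := NormedRing.inverse_continuousAt y
      rw [hy] at h1
      exact ContinuousAt.comp (f := fun z : ℝ => 1 + z • T) h1 (by fun_prop)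
    exact this.clm_apply continuous_const
  · have h1 := Ring.mul_inverse_cancel _ (isUnit_one_add_smul_of_norm_pow_le hT z)
    exact eq_sub_of_add_eq (congrArg (fun A : E →L[ℝ] E => A φ) h1)

end Neumann

section Volterra

open MeasureTheory

/-- A bounded measurable weight on `[0,1]`. -/
structure IsWeight (g : ℝ → ℝ) (K : ℝ) : Prop where
  nonneg : 0 ≤ K
  measurable : AEStronglyMeasurable g (volume.restrict (Icc 0 1))
  bound : ∀ x ∈ Icc (0 : ℝ) 1, |g x| ≤ K

variable {g : ℝ → ℝ} {K : ℝ}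

theorem isWeight_one : IsWeight (fun _ => 1) 1 :=
  ⟨zero_le_one, aestronglyMeasurable_const, fun _ _ => by simp⟩

theorem IsWeight.integrableOn (hg : IsWeight g K) (f : C(Icc (0 : ℝ) 1, ℝ)) :
    IntegrableOn (fun t => g t * IccExtend zero_le_one f t) (Icc 0 1) := by
  have hf : Continuous (IccExtend (zero_le_one (α := ℝ)) f) := f.continuous.Icc_extend'
  refine Integrable.of_bound (hg.measurable.mul hf.aestronglyMeasurable) (K * ‖f‖) ?_
  filter_upwards [ae_restrict_mem measurableSet_Icc] with x hx
  rw [norm_mul]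
  exact mul_le_mul (hg.bound x hx) (f.norm_coe_le_norm _) (norm_nonneg _) hg.nonneg

theorem IsWeight.intervalIntegrable (hg : IsWeight g K) (f : C(Icc (0 : ℝ) 1, ℝ))
    {x : ℝ} (hx : x ∈ Icc (0 : ℝ) 1) :
    IntervalIntegrable (fun t => g t * IccExtend zero_le_one f t) volume 0 x := by
  rw [intervalIntegrable_iff_integrableOn_Icc_of_le hx.1]
  exact (hg.integrableOn f).mono_set (Icc_subset_Icc_right hx.2)

theorem IsWeight.continuousOn_primitive (hg : IsWeight g K) (f : C(Icc (0 : ℝ) 1, ℝ)) :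
    ContinuousOn (fun x => ∫ t in (0 : ℝ)..x, g t * IccExtend zero_le_one f t) (Icc 0 1) := by
  have h01 : uIcc (0 : ℝ) 1 = Icc 0 1 := uIcc_of_le zero_le_one
  have := intervalIntegral.continuousOn_primitive_interval (a := (0 : ℝ)) (b := 1)
    (f := fun t => g t * IccExtend zero_le_one f t) (μ := volume) (h01.symm ▸ hg.integrableOn f)
  exact this.mono h01.ge

theorem IsWeight.abs_integral_le (hg : IsWeight g K) (f : C(Icc (0 : ℝ) 1, ℝ)) {c : ℝ} {n : ℕ}
    (hf : ∀ t : Icc (0 : ℝ) 1, |f t| ≤ c * (t : ℝ) ^ n) {x : ℝ} (hx : x ∈ Icc (0 : ℝ) 1) :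
    |∫ t in (0 : ℝ)..x, g t * IccExtend zero_le_one f t| ≤ K * c / (n + 1) * x ^ (n + 1) := by
  have h1 : ‖∫ t in (0 : ℝ)..x, g t * IccExtend zero_le_one f t‖ ≤
      ∫ t in (0 : ℝ)..x, K * c * t ^ n := by
    refine intervalIntegral.norm_integral_le_of_norm_le hx.1 (ae_of_all _ fun t ht => ?_)
      (by apply Continuous.intervalIntegrable; fun_prop)
    have ht' : t ∈ Icc (0 : ℝ) 1 := ⟨ht.1.le, ht.2.trans hx.2⟩
    rw [norm_mul, IccExtend_of_mem _ _ ht', mul_assoc]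
    exact mul_le_mul (hg.bound t ht') (hf ⟨t, ht'⟩) (norm_nonneg _) hg.nonneg
  refine h1.trans (le_of_eq ?_)
  rw [intervalIntegral.integral_const_mul, integral_pow]
  simp
  ring

/-- The operator `f ↦ ∫₀ˣ g f` on `C([0,1])`. -/
noncomputable def volterra (hg : IsWeight g K) :
    C(Icc (0 : ℝ) 1, ℝ) →L[ℝ] C(Icc (0 : ℝ) 1, ℝ) :=
  LinearMap.mkContinuous
    { toFun := fun f =>
        ⟨fun x => ∫ t in (0 : ℝ)..x, g t * IccExtend zero_le_one f t,
          continuousOn_iff_continuous_domRestrict.1 (hg.continuousOn_primitive f)⟩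
      map_add' := fun f₁ f₂ => by
        ext x
        change (∫ t in (0 : ℝ)..x, g t * IccExtend zero_le_one (f₁ + f₂) t) =
          (∫ t in (0 : ℝ)..x, g t * IccExtend zero_le_one f₁ t) +
            ∫ t in (0 : ℝ)..x, g t * IccExtend zero_le_one f₂ t
        rw [← intervalIntegral.integral_add (hg.intervalIntegrable f₁ x.2)
          (hg.intervalIntegrable f₂ x.2)]
        congr 1 with t
        simp [IccExtend, mul_add]
      map_smul' := fun c f => by
        ext x
        change (∫ t in (0 : ℝ)..x, g t * IccExtend zero_le_one (c • f) t) =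
          c * ∫ t in (0 : ℝ)..x, g t * IccExtend zero_le_one f t
        rw [← intervalIntegral.integral_const_mul]
        congr 1 with t
        simp [IccExtend]
        ring }
    K (fun f => by
      refine (ContinuousMap.norm_le _ (mul_nonneg hg.nonneg (norm_nonneg _))).2 fun x => ?_
      have := hg.abs_integral_le f (c := ‖f‖) (n := 0)
        (fun t => by simpa using f.norm_coe_le_norm t) x.2
      refine this.trans ?_
      simpa using mul_le_mul_of_nonneg_left x.2.2 (mul_nonneg hg.nonneg (norm_nonneg f)))

theorem volterra_apply (hg : IsWeight g K) (f : C(Icc (0 : ℝ) 1, ℝ)) (x : Icc (0 : ℝ) 1) :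
    volterra hg f x = ∫ t in (0 : ℝ)..x, g t * IccExtend zero_le_one f t := rfl

/-- The operator `f ↦ ∫₀ˣ ∫₀ˢ g f` on `C([0,1])`. -/
noncomputable def doubleVolterra (hg : IsWeight g K) :
    C(Icc (0 : ℝ) 1, ℝ) →L[ℝ] C(Icc (0 : ℝ) 1, ℝ) :=
  volterra isWeight_one ∘L volterra hg

theorem abs_doubleVolterra_le (hg : IsWeight g K) (f : C(Icc (0 : ℝ) 1, ℝ)) {c : ℝ} {n : ℕ}
    (hc : 0 ≤ c) (hf : ∀ t : Icc (0 : ℝ) 1, |f t| ≤ c * (t : ℝ) ^ n) (x : Icc (0 : ℝ) 1) :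
    |doubleVolterra hg f x| ≤ K * c / (n + 1) * (x : ℝ) ^ (n + 1) := by
  have hA : 0 ≤ K * c / (n + 1) := div_nonneg (mul_nonneg hg.nonneg hc) (by positivity)
  have h1 : ∀ t : Icc (0 : ℝ) 1, |volterra hg f t| ≤ K * c / (n + 1) * (t : ℝ) ^ (n + 1) :=
    fun t => hg.abs_integral_le f hf t.2
  refine (isWeight_one.abs_integral_le (volterra hg f) h1 x.2).trans ?_
  rw [one_mul, pow_succ (x : ℝ) (n + 1), ← mul_assoc]
  have hpow : 0 ≤ (x : ℝ) ^ (n + 1) := pow_nonneg x.2.1 _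
  refine (mul_le_of_le_one_right (by positivity) x.2.2).trans ?_
  exact mul_le_mul_of_nonneg_right (div_le_self hA (by push_cast; linarith [n.cast_nonneg (α := ℝ)]))
    hpow

theorem abs_doubleVolterra_pow_le (hg : IsWeight g K) (f : C(Icc (0 : ℝ) 1, ℝ)) (n : ℕ) :
    ∀ x : Icc (0 : ℝ) 1,
      |(doubleVolterra hg ^ n) f x| ≤ K ^ n / n.factorial * ‖f‖ * (x : ℝ) ^ n := by
  induction n with
  | zero => intro x; simpa using f.norm_coe_le_norm x
  | succ n ih =>
    intro x
    rw [pow_succ']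
    refine (abs_doubleVolterra_le hg _ (mul_nonneg (div_nonneg (pow_nonneg hg.nonneg _)
      (by positivity)) (norm_nonneg _)) ih x).trans (le_of_eq ?_)
    rw [Nat.factorial_succ]
    push_cast
    field_simp
    ring

theorem norm_doubleVolterra_pow_le (hg : IsWeight g K) (n : ℕ) :
    ‖doubleVolterra hg ^ n‖ ≤ K ^ n / n.factorial := by
  have hn : 0 ≤ K ^ n / n.factorial := div_nonneg (pow_nonneg hg.nonneg _) (by positivity)
  refine ContinuousLinearMap.opNorm_le_bound _ hn fun f => ?_
  refine (ContinuousMap.norm_le _ (mul_nonneg hn (norm_nonneg _))).2 fun x => ?_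
  exact (abs_doubleVolterra_pow_le hg f n x).trans
    (mul_le_of_le_one_right (mul_nonneg hn (norm_nonneg _)) (pow_le_one₀ x.2.1 x.2.2))

end Volterra

theorem PiecewiseContinuous.exists_isWeight {p : ℝ → ℝ} (hp : PiecewiseContinuous p) :
    ∃ K, IsWeight p K := by
  obtain ⟨K, h0, hK⟩ := hp.bounded
  exact ⟨K, h0, hp.aestronglyMeasurable, hK⟩

/-- Solutions of `u'' = -z p u` with given initial data, depending continuously on `z`. -/
theorem PiecewiseContinuous.exists_solution_family {p : ℝ → ℝ} (hp : PiecewiseContinuous p)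
    (a b : ℝ) : ∃ U V : ℝ → ℝ → ℝ,
      (∀ z, IsRealSolution (fun x => z * p x) (U z) (V z)) ∧ (∀ z, U z 0 = a ∧ V z 0 = b) ∧
      Continuous (Function.uncurry U) ∧ Continuous (Function.uncurry V) := by
  obtain ⟨K, hK⟩ := hp.exists_isWeight
  obtain ⟨F, hF⟩ := hp.1
  let φ : C(Icc (0 : ℝ) 1, ℝ) := ⟨fun x => a + b * x, by fun_prop⟩
  obtain ⟨s, hs, eqn⟩ := exists_continuous_resolvent (norm_doubleVolterra_pow_le hK) φ
  let w : ℝ → C(Icc (0 : ℝ) 1, ℝ) := fun z => ContinuousMap.const _ b - z • volterra hK (s z)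
  have hw : Continuous w := by fun_prop
  have joint : ∀ {r : ℝ → C(Icc (0 : ℝ) 1, ℝ)}, Continuous r →
      Continuous (Function.uncurry fun z x => IccExtend zero_le_one (r z) x) := by
    intro r hr
    have : Continuous fun y : ℝ × ℝ => r y.1 (projIcc 0 1 zero_le_one y.2) :=
      (hr.comp continuous_fst).eval (continuous_projIcc.comp continuous_snd)
    exact this
  have hU : ∀ z, ∀ x ∈ Icc (0 : ℝ) 1, IccExtend zero_le_one (s z) x =
      a + ∫ t in (0 : ℝ)..x, IccExtend zero_le_one (w z) t := by
    intro z x hx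
    have e := congrArg (fun f : C(Icc (0 : ℝ) 1, ℝ) => f ⟨x, hx⟩) (eqn z)
    rw [IccExtend_of_mem _ _ hx]
    refine e.trans ?_
    have h2 : ∀ t, IccExtend zero_le_one (w z) t =
        b - z * (1 * IccExtend zero_le_one (volterra hK (s z)) t) := by
      intro t; simp [IccExtend, w]
    simp only [h2]
    rw [intervalIntegral.integral_sub (by simp)
      ((isWeight_one.intervalIntegrable _ hx).const_mul z), intervalIntegral.integral_const_mul]
    simp only [ContinuousMap.sub_apply, ContinuousMap.smul_apply, smul_eq_mul, φ, doubleVolterra,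
      ContinuousLinearMap.comp_apply, volterra_apply, ContinuousMap.coe_mk,
      intervalIntegral.integral_const]
    ring
  have hV : ∀ z, ∀ x ∈ Icc (0 : ℝ) 1, IccExtend zero_le_one (w z) x =
      b - z * ∫ t in (0 : ℝ)..x, p t * IccExtend zero_le_one (s z) t := by
    intro z x hx
    rw [IccExtend_of_mem _ _ hx]
    rfl
  have hcs : ∀ z, Continuous (IccExtend (zero_le_one (α := ℝ)) (s z)) :=
    fun z => (s z).continuous.Icc_extend'
  have hcw : ∀ z, Continuous (IccExtend (zero_le_one (α := ℝ)) (w z)) :=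
    fun z => (w z).continuous.Icc_extend'
  have m0 : (0 : ℝ) ∈ Icc (0 : ℝ) 1 := ⟨le_rfl, zero_le_one⟩
  refine ⟨fun z => IccExtend zero_le_one (s z), fun z => IccExtend zero_le_one (w z),
    fun z => ⟨?_, ?_, F, ?_⟩, fun z => ⟨?_, ?_⟩, joint hs, joint hw⟩
  · intro x hx
    have hd : HasDerivAt (fun x => a + ∫ t in (0 : ℝ)..x, IccExtend zero_le_one (w z) t)
        (IccExtend zero_le_one (w z) x) x :=
      ((hcw z).integral_hasStrictDerivAt 0 x).hasDerivAt.const_add a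
    exact hd.hasDerivWithinAt.congr (hU z) (hU z x hx)
  · exact (hcw z).continuousOn
  · intro x hx hxF
    have hx' := Ioo_subset_Icc_self hx
    have hn : Icc (0 : ℝ) 1 ∈ 𝓝 x := Icc_mem_nhds hx.1 hx.2
    have hpx : ContinuousAt p x := (hF x hx' hxF).continuousAt hn
    have hd := intervalIntegral.integral_hasDerivAt_right (hK.intervalIntegrable (s z) hx')
      ⟨Icc 0 1, hn, (hK.integrableOn (s z)).aestronglyMeasurable⟩
      (hpx.mul (hcs z).continuousAt)
    have hd2 := (hd.const_mul z).const_sub b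
    refine (hd2.congr_of_eventuallyEq ?_).congr_deriv ?_
    · filter_upwards [hn] with y hy using hV z y hy
    · simp [mul_assoc]
  · exact (hU z 0 m0).trans (by simp)
  · exact (hV z 0 m0).trans (by simp)

/-- `U z` solves `u'' = -z p u` with `u(0) = sin α`, `u'(0) = -cos α`, and `V z` is its
derivative; both depend continuously on `z`. -/
structure IsShootingFamily (p : ℝ → ℝ) (α : ℝ) (U V : ℝ → ℝ → ℝ) : Prop where
  sol : ∀ z, IsRealSolution (fun x => z * p x) (U z) (V z)
  left : ∀ z, U z 0 = Real.sin α
  left_deriv : ∀ z, V z 0 = -Real.cos α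
  cont : Continuous (Function.uncurry U)
  cont_deriv : Continuous (Function.uncurry V)

theorem PiecewiseContinuous.exists_isShootingFamily {p : ℝ → ℝ} (hp : PiecewiseContinuous p)
    (α : ℝ) : ∃ U V, IsShootingFamily p α U V := by
  obtain ⟨U, V, h1, h2, h3, h4⟩ := hp.exists_solution_family (Real.sin α) (-Real.cos α)
  exact ⟨U, V, h1, fun z => (h2 z).1, fun z => (h2 z).2, h3, h4⟩

theorem IsSolution.isRealSolution_comp {p : ℝ → ℝ} {z : ℝ} {u v : ℝ → ℂ}
    (h : IsSolution p z u v) (L : ℂ →L[ℝ] ℝ) :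
    IsRealSolution (fun x => z * p x) (fun x => L (u x)) (fun x => L (v x)) := by
  refine ⟨fun x hx => L.hasFDerivAt.comp_hasDerivWithinAt x (h.hasDeriv x hx),
    L.continuous.comp_continuousOn h.continuousOn_deriv, ?_⟩
  obtain ⟨F, hF⟩ := h.equation
  refine ⟨F, fun x hx hxF => ?_⟩
  obtain ⟨w, hw, e⟩ := hF x hx hxF
  refine (L.hasFDerivAt.comp_hasDerivAt x hw).congr_deriv ?_
  have e' : w = -((z * p x : ℝ) • u x) := by
    rw [← neg_eq_iff_eq_neg, e, Complex.real_smul]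
    push_cast
    ring
  rw [e', map_neg, map_smul, smul_eq_mul]

theorem IsRealSolution.isSolution_ofReal {p u v : ℝ → ℝ} {z : ℝ}
    (h : IsRealSolution (fun x => z * p x) u v) :
    IsSolution p z (fun x => (u x : ℂ)) (fun x => (v x : ℂ)) := by
  refine ⟨fun x hx => (h.hasDeriv x hx).ofReal_comp,
    Complex.continuous_ofReal.comp_continuousOn h.continuousOn_deriv, ?_⟩
  obtain ⟨F, hF⟩ := h.equation
  refine ⟨F, fun x hx hxF => ⟨_, (hF x hx hxF).ofReal_comp, ?_⟩⟩
  push_cast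
  ring

theorem IsRealSolution.deriv_nonpos_of_pos_left {P u v : ℝ → ℝ} (h : IsRealSolution P u v)
    {y : ℝ} (hy : y ∈ Ioc (0 : ℝ) 1) (hpos : ∀ x ∈ Ioo 0 y, 0 < u x) (huy : u y = 0) :
    v y ≤ 0 := by
  have hd : HasDerivWithinAt u (v y) (Iio y) y := by
    refine (h.hasDeriv y ⟨hy.1.le, hy.2⟩).mono_of_mem_nhdsWithin ?_
    filter_upwards [Ioo_mem_nhdsLT hy.1] with x hx using ⟨hx.1.le, hx.2.le.trans hy.2⟩
  have hs := (hasDerivWithinAt_iff_tendsto_slope' (by simp)).1 hd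
  refine le_of_tendsto hs ?_
  filter_upwards [Ioo_mem_nhdsLT hy.1] with x hx
  rw [slope_def_field, huy, sub_zero]
  exact div_nonpos_of_nonneg_of_nonpos (hpos x hx).le (by linarith [hx.2])

namespace IsShootingFamily

variable {p : ℝ → ℝ} {α β : ℝ} {U V : ℝ → ℝ → ℝ}

/-- Every solution with the same boundary condition at `0` is a multiple of the shooting
solution, and the zeros of the shooting solution are simple. -/
theorem eq_smul_and_simple (hp : PiecewiseContinuous p) (h : IsShootingFamily p α U V) (z : ℝ) :
    (∀ u v, IsRealSolution (fun x => z * p x) u v → u 0 * Real.cos α + v 0 * Real.sin α = 0 →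
      ∃ c : ℝ, ∀ x ∈ Icc (0 : ℝ) 1, u x = c * U z x ∧ v x = c * V z x) ∧
    ∀ x ∈ Icc (0 : ℝ) 1, U z x = 0 → V z x ≠ 0 := by
  obtain ⟨A, B, hs, hi, -, -⟩ := hp.exists_solution_family (Real.cos α) (Real.sin α)
  have hW : ∀ x ∈ Icc (0 : ℝ) 1, U z x * B z x - V z x * A z x = 1 := by
    intro x hx
    rw [(h.sol z).wronskian_eq (hs z) hx, h.left, h.left_deriv, (hi z).1, (hi z).2]
    nlinarith [Real.sin_sq_add_cos_sq α]
  refine ⟨fun u v hu h0 => ⟨u 0 * B z 0 - v 0 * A z 0, fun x hx => ?_⟩, fun x hx h1 h2 => ?_⟩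
  · have e1 := hu.wronskian_eq (hs z) hx
    have e2 := hu.wronskian_eq (h.sol z) hx
    have e3 := hW x hx
    have e4 : u 0 * V z 0 - v 0 * U z 0 = 0 := by
      rw [h.left, h.left_deriv]; linarith
    rw [e4] at e2
    rw [← e1]
    constructor
    · linear_combination (-u x) * e3 - A z x * e2
    · linear_combination (-v x) * e3 - B z x * e2
  · have := hW x hx
    rw [h1, h2] at this
    simp at this

theorem ne_zero_deriv (hp : PiecewiseContinuous p) (h : IsShootingFamily p α U V) (z : ℝ) {x : ℝ}
    (hx : x ∈ Icc (0 : ℝ) 1) (hz : U z x = 0) : V z x ≠ 0 :=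
  (h.eq_smul_and_simple hp z).2 x hx hz

theorem isEigenvalue_iff (hp : PiecewiseContinuous p) (h : IsShootingFamily p α U V) (z : ℝ) :
    IsEigenvalue p α β z ↔ U z 1 * Real.cos β + V z 1 * Real.sin β = 0 := by
  have m1 : (1 : ℝ) ∈ Icc (0 : ℝ) 1 := ⟨zero_le_one, le_rfl⟩
  constructor
  · rintro ⟨u, v, hs, h0, h1, x, hx, hne⟩
    obtain ⟨L, hL⟩ : ∃ L : ℂ →L[ℝ] ℝ, L (u x) ≠ 0 := by
      by_contra! hall
      exact hne (Complex.ext (hall Complex.reCLM) (hall Complex.imCLM))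
    have bc : ∀ (a b : ℂ) (γ : ℝ), a * (Real.cos γ : ℂ) + b * (Real.sin γ : ℂ) = 0 →
        L a * Real.cos γ + L b * Real.sin γ = 0 := by
      intro a b γ hab
      have := congrArg L hab
      rwa [map_add, map_zero, mul_comm a, mul_comm b, ← Complex.real_smul, ← Complex.real_smul,
        map_smul, map_smul, smul_eq_mul, smul_eq_mul, mul_comm _ (L a), mul_comm _ (L b)] at this
    obtain ⟨c, hc⟩ := (h.eq_smul_and_simple hp z).1 _ _ (hs.isRealSolution_comp L)
      (bc _ _ _ h0)
    have hc0 : c ≠ 0 := by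
      rintro rfl
      exact hL (by simpa using (hc x hx).1)
    have e := bc _ _ _ h1
    simp only [(hc 1 m1).1, (hc 1 m1).2] at e
    exact (mul_eq_zero.1 (by linarith : c * (U z 1 * Real.cos β + V z 1 * Real.sin β) = 0)
      ).resolve_left hc0
  · intro e
    refine ⟨_, _, (h.sol z).isSolution_ofReal, ?_, by exact_mod_cast e, ?_⟩
    · rw [h.left, h.left_deriv]; push_cast; ring
    · by_contra! hall
      have hU : ∀ x ∈ Icc (0 : ℝ) 1, U z x = 0 := fun x hx => by exact_mod_cast hall x hx
      have hx : (1 / 2 : ℝ) ∈ Ioo (0 : ℝ) 1 := by norm_num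
      refine h.ne_zero_deriv hp z (Ioo_subset_Icc_self hx) (hU _ (Ioo_subset_Icc_self hx)) ?_
      refine ((h.sol z).hasDerivAt hx).unique
        ((hasDerivAt_const _ (0 : ℝ)).congr_of_eventuallyEq ?_)
      filter_upwards [Icc_mem_nhds hx.1 hx.2] with y hy using hU y hy

theorem continuous_right (h : IsShootingFamily p α U V) :
    Continuous fun z => U z 1 * Real.cos β + V z 1 * Real.sin β := by
  have h1 : Continuous fun z => U z 1 :=
    h.cont.comp (Continuous.prodMk continuous_id continuous_const)
  have h2 : Continuous fun z => V z 1 :=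
    h.cont_deriv.comp (Continuous.prodMk continuous_id continuous_const)
  fun_prop

/-- A nonnegative shooting solution is positive in the interior. -/
theorem pos_of_nonneg (hp : PiecewiseContinuous p) (h : IsShootingFamily p α U V) {z : ℝ}
    (hU : ∀ x ∈ Icc (0 : ℝ) 1, 0 ≤ U z x) : ∀ x ∈ Ioo (0 : ℝ) 1, 0 < U z x := by
  intro x hx
  refine (hU x (Ioo_subset_Icc_self hx)).lt_of_ne fun e => ?_
  refine h.ne_zero_deriv hp z (Ioo_subset_Icc_self hx) e.symm ?_
  refine IsLocalMin.hasDerivAt_eq_zero (f := U z) ?_ ((h.sol z).hasDerivAt hx)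
  filter_upwards [Icc_mem_nhds hx.1 hx.2] with y hy
  rw [← e]
  exact hU y hy

/-- Near `x = 0` and near any parameter, shooting solutions are positive to the right of `0`. -/
theorem eventually_pos_zero (hα : α ∈ Ioc 0 Real.pi) (h : IsShootingFamily p α U V) (z : ℝ) :
    ∀ᶠ y : ℝ × ℝ in 𝓝 (z, 0), y.2 ∈ Ioc (0 : ℝ) 1 → 0 < U y.1 y.2 := by
  rcases hα.2.eq_or_lt with rfl | hlt
  · have h0 : ∀ᶠ y : ℝ × ℝ in 𝓝 (z, (0 : ℝ)), 0 < Function.uncurry V y :=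
      h.cont_deriv.continuousAt.eventually (lt_mem_nhds (by simp [h.left_deriv]))
    obtain ⟨ε, hε, hb⟩ := Metric.eventually_nhds_iff.1 h0
    refine Metric.eventually_nhds_iff.2 ⟨ε, hε, ?_⟩
    rintro ⟨w, x⟩ hy hx
    simp only at hx ⊢
    have hsub : Icc 0 x ⊆ Icc (0 : ℝ) 1 := Icc_subset_Icc_right hx.2
    have hmono : StrictMonoOn (U w) (Icc 0 x) := by
      refine strictMonoOn_of_hasDerivWithinAt_pos (f' := V w) (convex_Icc 0 x)
        ((h.sol w).continuousOn.mono hsub) ?_ ?_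
      · intro t ht
        rw [interior_Icc] at ht
        exact ((h.sol w).hasDerivAt ⟨ht.1, ht.2.trans_le hx.2⟩).hasDerivWithinAt
      · intro t ht
        rw [interior_Icc] at ht
        refine hb (y := (w, t)) (lt_of_le_of_lt ?_ hy)
        simp only [Prod.dist_eq, Real.dist_eq, sub_zero]
        refine max_le_max le_rfl ?_
        rw [abs_of_pos ht.1, abs_of_pos hx.1]
        exact ht.2.le
    have := hmono ⟨le_rfl, hx.1.le⟩ ⟨hx.1.le, le_rfl⟩ hx.1
    rwa [h.left, Real.sin_pi] at this
  · have : ∀ᶠ y : ℝ × ℝ in 𝓝 (z, (0 : ℝ)), 0 < Function.uncurry U y :=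
      h.cont.continuousAt.eventually
        (lt_mem_nhds (by simpa [h.left] using Real.sin_pos_of_pos_of_lt_pi hα.1 hlt))
    exact this.mono fun y hy _ => hy

theorem isOpen_pos (hα : α ∈ Ioc 0 Real.pi) (h : IsShootingFamily p α U V) :
    IsOpen {z : ℝ | ∀ x ∈ Ioc (0 : ℝ) 1, 0 < U z x} := by
  rw [isOpen_iff_mem_nhds]
  intro z hz
  have key : ∀ᶠ w in 𝓝 z, ∀ x ∈ Icc (0 : ℝ) 1, x ∈ Ioc (0 : ℝ) 1 → 0 < U w x := by
    refine isCompact_Icc.eventually_forall_of_forall_eventually fun x hx => ?_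
    rcases hx.1.eq_or_lt with rfl | h0
    · exact h.eventually_pos_zero hα z
    · have : ∀ᶠ y : ℝ × ℝ in 𝓝 (z, x), 0 < Function.uncurry U y :=
        h.cont.continuousAt.eventually (lt_mem_nhds (hz x ⟨h0, hx.2⟩))
      exact this.mono fun y hy _ => hy
  filter_upwards [key] with w hw x hx using hw x (Ioc_subset_Icc_self hx) hx

/-- For very negative parameters the shooting solution is positive and violates the boundary
condition at `1` with a definite sign. -/
theorem exists_threshold (hp : IsDensity p) (hα : α ∈ Ioc 0 Real.pi) (hβ : β ∈ Ico 0 Real.pi)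
    (h : IsShootingFamily p α U V) : ∃ Λ : ℝ, ∀ z ≤ Λ, (∀ x ∈ Ioc (0 : ℝ) 1, 0 < U z x) ∧
      0 < U z 1 * Real.cos β + V z 1 * Real.sin β := by
  obtain ⟨c, hc, hpc⟩ := hp.boundedAway
  obtain ⟨A, hA⟩ : ∃ A : ℝ, Real.cos α ≤ A * Real.sin α := by
    rcases hα.2.eq_or_lt with rfl | hlt
    · exact ⟨0, by simp⟩
    · have := Real.sin_pos_of_pos_of_lt_pi hα.1 hlt
      exact ⟨Real.cos α / Real.sin α, by rw [div_mul_cancel₀ _ this.ne']⟩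
  have hsβ : 0 ≤ Real.sin β := Real.sin_nonneg_of_nonneg_of_le_pi hβ.1 hβ.2.le
  obtain ⟨B, hB⟩ : ∃ B : ℝ, 0 < Real.cos β + B * Real.sin β := by
    rcases hβ.1.eq_or_lt with rfl | hlt
    · exact ⟨0, by simp⟩
    · have := Real.sin_pos_of_pos_of_lt_pi hlt hβ.2
      exact ⟨(1 - Real.cos β) / Real.sin β, by rw [div_mul_cancel₀ _ this.ne']; simp⟩
  let φ : ℝ → ℝ := fun x => -A + (A + B) * x
  let w : ℝ → ℝ := fun x => Real.exp (-A * x + (A + B) * (x ^ 2 / 2))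
  let R : ℝ → ℝ := fun x => -((A + B) + φ x ^ 2)
  have hw : ∀ x, HasDerivAt w (φ x * w x) x := by
    intro x
    have h1 : HasDerivAt (fun x : ℝ => -A * x + (A + B) * (x ^ 2 / 2)) (φ x) x := by
      have := ((hasDerivAt_id x).const_mul (-A)).add
        ((((hasDerivAt_id x).pow 2).div_const 2).const_mul (A + B))
      refine this.congr_deriv ?_
      simp [φ]
    exact h1.exp.congr_deriv (mul_comm _ _)
  have hφ : ∀ x, HasDerivAt φ (A + B) x := fun x =>
    (((hasDerivAt_id x).const_mul (A + B)).const_add (-A)).congr_deriv (mul_one _)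
  have hwpos : ∀ x, 0 < w x := fun x => Real.exp_pos _
  have hv : ∀ x, HasDerivAt (fun x => φ x * w x) (-(R x * w x)) x := fun x =>
    ((hφ x).mul (hw x)).congr_deriv (by simp only [R]; ring)
  have hsolw : IsRealSolution R w (fun x => φ x * w x) :=
    ⟨fun x _ => (hw x).hasDerivWithinAt,
      fun x _ => (hv x).continuousAt.continuousWithinAt, ∅, fun x _ _ => hv x⟩
  obtain ⟨M, hM⟩ : ∃ M, ∀ x ∈ Icc (0 : ℝ) 1, |R x| ≤ M := by
    have : ContinuousOn R (Icc 0 1) := by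
      apply Continuous.continuousOn; simp only [R, φ]; fun_prop
    obtain ⟨M, hM⟩ := isCompact_Icc.exists_bound_of_continuousOn this
    exact ⟨M, hM⟩
  have hM0 : 0 ≤ M := (abs_nonneg _).trans (hM 0 ⟨le_rfl, zero_le_one⟩)
  refine ⟨-(M / c), fun z hz => ?_⟩
  have hz0 : z ≤ 0 := hz.trans (neg_nonpos.2 (div_nonneg hM0 hc.le))
  have hcoef : ∀ x ∈ Icc (0 : ℝ) 1, z * p x - R x ≤ 0 := by
    intro x hx
    have h1 : z * p x ≤ z * c := mul_le_mul_of_nonpos_left (hpc x hx) hz0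
    have h2 : z * c ≤ -M := by
      calc z * c ≤ -(M / c) * c := mul_le_mul_of_nonneg_right hz hc.le
        _ = -M := by field_simp
    linarith [(abs_le.1 (hM x hx)).1]
  have hW : ∀ y ∈ Ioc (0 : ℝ) 1, (∀ x ∈ Ioo 0 y, 0 < U z x) → U z y * φ y ≤ V z y := by
    intro y hy hpos
    have hanti := (h.sol z).antitoneOn_wronskian hsolw hy.2 (fun x hx =>
      mul_nonpos_of_nonpos_of_nonneg (hcoef x ⟨hx.1.le, hx.2.le.trans hy.2⟩)
        (mul_pos (hpos x hx) (hwpos x)).le) ⟨le_rfl, hy.1.le⟩ ⟨hy.1.le, le_rfl⟩ hy.1.le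
    simp only [h.left, h.left_deriv] at hanti
    have h0 : Real.sin α * (φ 0 * w 0) - -Real.cos α * w 0 ≤ 0 := by
      have : φ 0 = -A := by simp [φ]
      rw [this]
      nlinarith [hwpos 0]
    have h1 : (U z y * φ y - V z y) * w y ≤ 0 := by linarith
    have := nonpos_of_mul_nonpos_left h1 (hwpos y)
    linarith
  have hpos : ∀ x ∈ Ioc (0 : ℝ) 1, 0 < U z x := by
    by_contra! hcon
    obtain ⟨x₀, hx₀, hle⟩ := hcon
    obtain ⟨δ, hδ, hδpos⟩ : ∃ δ > 0, ∀ x ∈ Ioo (0 : ℝ) δ, x ≤ 1 → 0 < U z x := by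
      have hcont : Tendsto (fun x : ℝ => (z, x)) (𝓝 0) (𝓝 (z, 0)) :=
        (Continuous.prodMk continuous_const continuous_id).tendsto' _ _ rfl
      obtain ⟨δ, hδ, hb⟩ := Metric.eventually_nhds_iff.1
        (hcont.eventually (h.eventually_pos_zero hα z))
      refine ⟨δ, hδ, fun x hx hx1 => hb ?_ ⟨hx.1, hx1⟩⟩
      rw [Real.dist_eq, sub_zero, abs_of_pos hx.1]
      exact hx.2
    let S : Set ℝ := {x ∈ Icc (min δ x₀) 1 | U z x ≤ 0}
    have hcu : Continuous (U z) :=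
      h.cont.comp (Continuous.prodMk continuous_const continuous_id)
    have hSc : IsCompact S :=
      isCompact_Icc.inter_right (isClosed_le hcu continuous_const)
    obtain ⟨y, hy, hmin⟩ := hSc.exists_isLeast ⟨x₀, ⟨min_le_right _ _, hx₀.2⟩, hle⟩
    have hy0 : 0 < y := (lt_min hδ hx₀.1).trans_le hy.1.1
    have hbefore : ∀ x ∈ Ioo 0 y, 0 < U z x := by
      intro x hx
      by_contra! hx'
      rcases lt_or_ge x (min δ x₀) with hlt | hge
      · exact absurd (hδpos x ⟨hx.1, hlt.trans_le (min_le_left _ _)⟩ (hx.2.le.trans hy.1.2))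
          (not_lt.2 hx')
      · exact absurd (hmin ⟨⟨hge, hx.2.le.trans hy.1.2⟩, hx'⟩) (not_le.2 hx.2)
    have hyI : y ∈ Icc (0 : ℝ) 1 := ⟨hy0.le, hy.1.2⟩
    have hUy : U z y = 0 := by
      refine le_antisymm hy.2 ?_
      refine ge_of_tendsto (hcu.continuousWithinAt (s := Iio y) (x := y)) ?_
      filter_upwards [Ioo_mem_nhdsLT hy0] with x hx using (hbefore x hx).le
    have hVy : V z y ≤ 0 := (h.sol z).deriv_nonpos_of_pos_left ⟨hy0, hy.1.2⟩ hbefore hUy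
    have := hW y ⟨hy0, hy.1.2⟩ hbefore
    rw [hUy, zero_mul] at this
    exact h.ne_zero_deriv hp.piecewiseContinuous z hyI hUy (le_antisymm hVy this)
  refine ⟨hpos, ?_⟩
  have h1 : (1 : ℝ) ∈ Ioc (0 : ℝ) 1 := ⟨one_pos, le_rfl⟩
  have hV1 := hW 1 h1 fun x hx => hpos x ⟨hx.1, hx.2.le⟩
  have hφ1 : φ 1 = B := by simp [φ]
  rw [hφ1] at hV1
  have := mul_pos (hpos 1 h1) hB
  nlinarith [mul_le_mul_of_nonneg_right hV1 hsβ]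

/-- The shooting solution of the lowest eigenvalue is positive on `(0,1)`. -/
theorem pos_of_isLowestEigenvalue (hp : IsDensity p) (hα : α ∈ Ioc 0 Real.pi)
    (hβ : β ∈ Ico 0 Real.pi) (h : IsShootingFamily p α U V) {l : ℝ}
    (hl : IsLowestEigenvalue p α β l) : ∀ x ∈ Ioo (0 : ℝ) 1, 0 < U l x := by
  have hpc := hp.piecewiseContinuous
  by_cases hlB : ∀ x ∈ Ioc (0 : ℝ) 1, 0 < U l x
  · exact fun x hx => hlB x (Ioo_subset_Ioc_self hx)
  obtain ⟨Λ₀, hΛ₀⟩ := h.exists_threshold hp hα hβ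
  obtain ⟨Λ, hΛl, hΛ⟩ : ∃ Λ ≤ l, Λ ≤ Λ₀ := ⟨min l Λ₀, min_le_left _ _, min_le_right _ _⟩
  let S : Set ℝ := Icc Λ l ∩ {z : ℝ | ∀ x ∈ Ioc (0 : ℝ) 1, 0 < U z x}ᶜ
  have hSc : IsCompact S := isCompact_Icc.inter_right (h.isOpen_pos hα).isClosed_compl
  obtain ⟨k, hk, hmin⟩ := hSc.exists_isLeast ⟨l, ⟨hΛl, le_rfl⟩, hlB⟩
  have hΛk : Λ < k := lt_of_le_of_ne hk.1.1 fun e => hk.2 (e ▸ (hΛ₀ Λ hΛ).1)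
  have hbelow : ∀ z ∈ Ioo Λ k, ∀ x ∈ Ioc (0 : ℝ) 1, 0 < U z x := by
    intro z hz
    by_contra hcon
    exact absurd (hmin ⟨⟨hz.1.le, hz.2.le.trans hk.1.2⟩, hcon⟩) (not_le.2 hz.2)
  have hUz : ∀ x, Continuous fun z => U z x := fun x =>
    h.cont.comp (Continuous.prodMk continuous_id continuous_const)
  have hnonneg : ∀ x ∈ Icc (0 : ℝ) 1, 0 ≤ U k x := by
    intro x hx
    rcases hx.1.eq_or_lt with rfl | h0
    · rw [h.left]; exact Real.sin_nonneg_of_nonneg_of_le_pi hα.1.le hα.2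
    · refine ge_of_tendsto ((hUz x).continuousWithinAt (s := Iio k) (x := k)) ?_
      filter_upwards [Ioo_mem_nhdsLT hΛk] with z hz using (hbelow z hz x ⟨h0, hx.2⟩).le
  have hint := h.pos_of_nonneg hpc hnonneg
  have m1 : (1 : ℝ) ∈ Icc (0 : ℝ) 1 := ⟨zero_le_one, le_rfl⟩
  have hU1 : U k 1 = 0 := by
    by_contra hne
    refine hk.2 fun x hx => ?_
    rcases hx.2.eq_or_lt with rfl | hlt
    · exact (hnonneg 1 m1).lt_of_ne (Ne.symm hne)
    · exact hint x ⟨hx.1, hlt⟩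
  have hV1 : V k 1 ≤ 0 := (h.sol k).deriv_nonpos_of_pos_left ⟨one_pos, le_rfl⟩ hint hU1
  have hsβ : 0 ≤ Real.sin β := Real.sin_nonneg_of_nonneg_of_le_pi hβ.1 hβ.2.le
  have hFk : U k 1 * Real.cos β + V k 1 * Real.sin β ≤ 0 := by
    rw [hU1, zero_mul, zero_add]
    exact mul_nonpos_of_nonpos_of_nonneg hV1 hsβ
  obtain ⟨μ, hμ, hFμ⟩ := intermediate_value_Icc' hΛk.le (h.continuous_right (β := β)).continuousOn
    ⟨hFk, (hΛ₀ Λ hΛ).2.le⟩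
  have hlμ : l ≤ μ := hl.2 ((h.isEigenvalue_iff hpc μ).2 hFμ)
  have : k = l := le_antisymm hk.1.2 (hlμ.trans hμ.2)
  rwa [this] at hint

end IsShootingFamily

/-- Under the restriction on the boundary parameters, `0` is not the lowest eigenvalue. -/
theorem IsLowestEigenvalue.ne_zero {p : ℝ → ℝ} {α β l : ℝ} (hp : IsDensity p)
    (hα : α ∈ Ioc 0 Real.pi) (hβ : β ∈ Ico 0 Real.pi)
    (hcurve : α ∈ Icc (Real.pi / 4) Real.pi → β ∈ Icc 0 (3 * Real.pi / 4) →
      Real.cos α * Real.cos β - Real.sin (α - β) ≠ 0)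
    (hl : IsLowestEigenvalue p α β l) : l ≠ 0 := by
  rintro rfl
  obtain ⟨U, V, h⟩ := hp.piecewiseContinuous.exists_isShootingFamily α
  have hpos := h.pos_of_isLowestEigenvalue hp hα hβ hl
  have m1 : (1 : ℝ) ∈ Icc (0 : ℝ) 1 := ⟨zero_le_one, le_rfl⟩
  have hF := (h.isEigenvalue_iff hp.piecewiseContinuous 0).1 hl.1
  have hlin : IsRealSolution (fun x => 0 * p x)
      (fun x => Real.sin α - x * Real.cos α) (fun _ => -Real.cos α) := by
    refine ⟨fun x _ => ?_, continuousOn_const, ∅, fun x _ _ => ?_⟩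
    · simpa using (((hasDerivAt_id x).mul_const (Real.cos α)).const_sub
        (Real.sin α)).hasDerivWithinAt
    · simpa using hasDerivAt_const x (-Real.cos α)
  obtain ⟨c, hc⟩ := (h.eq_smul_and_simple hp.piecewiseContinuous 0).1 _ _ hlin (by ring)
  have h0 := hc 0 ⟨le_rfl, zero_le_one⟩
  simp only [h.left, h.left_deriv] at h0
  have hc1 : c = 1 := by
    linear_combination (-Real.sin α) * h0.1 + Real.cos α * h0.2 +
      (1 - c) * Real.sin_sq_add_cos_sq α
  subst hc1
  obtain ⟨e1, e2⟩ := hc 1 m1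
  simp only [one_mul] at e1 e2
  rw [← e1, ← e2] at hF
  have hge : Real.cos α ≤ Real.sin α := by
    have hcu : Continuous (U 0) :=
      h.cont.comp (Continuous.prodMk continuous_const continuous_id)
    have : 0 ≤ U 0 1 := by
      refine ge_of_tendsto (hcu.continuousWithinAt (s := Iio 1) (x := 1)) ?_
      filter_upwards [Ioo_mem_nhdsLT (one_pos (α := ℝ))] with x hx using (hpos x hx).le
    linarith
  have hpi := Real.pi_pos
  have hα4 : Real.pi / 4 ≤ α := by
    by_contra! hlt
    have h1 := Real.sin_lt_sin_of_lt_of_le_pi_div_two (by linarith [hα.1])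
      (by linarith) hlt
    have h2 := Real.cos_lt_cos_of_nonneg_of_le_pi hα.1.le (by linarith) hlt
    rw [Real.sin_pi_div_four] at h1
    rw [Real.cos_pi_div_four] at h2
    linarith
  have hβ4 : β ≤ 3 * Real.pi / 4 := by
    by_contra! hlt
    have hs : 0 < Real.sin β := Real.sin_pos_of_pos_of_lt_pi (by linarith) hβ.2
    have hcb : Real.cos β < 0 := Real.cos_neg_of_pi_div_two_lt_of_lt (by linarith)
      (by linarith [hβ.2])
    have hsa : 0 ≤ Real.sin α := Real.sin_nonneg_of_nonneg_of_le_pi hα.1.le hα.2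
    have hsum : Real.sin β + Real.cos β < 0 := by
      have h1 : Real.sin (Real.pi - β) < Real.sin (Real.pi / 4) :=
        Real.sin_lt_sin_of_lt_of_le_pi_div_two (by linarith [hβ.2]) (by linarith) (by linarith)
      have h2 : Real.cos (Real.pi / 4) < Real.cos (Real.pi - β) :=
        Real.cos_lt_cos_of_nonneg_of_le_pi (by linarith [hβ.2]) (by linarith) (by linarith)
      rw [Real.sin_pi_sub, Real.sin_pi_div_four] at h1
      rw [Real.cos_pi_sub, Real.cos_pi_div_four] at h2
      linarith
    have hca : 0 ≤ Real.cos α := by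
      by_contra! hneg
      nlinarith [mul_pos_of_neg_of_neg hneg hsum, mul_nonneg hsa (neg_pos.2 hcb).le]
    have hca0 : Real.cos α = 0 := by
      refine le_antisymm ?_ hca
      by_contra! hp0
      nlinarith [mul_nonneg (sub_nonneg.2 hge) (neg_pos.2 hcb).le, mul_pos hp0 hs]
    have : Real.sin α = 0 := by
      have : Real.sin α * Real.cos β = 0 := by rw [hca0] at hF; linarith
      exact (mul_eq_zero.1 this).resolve_right hcb.ne
    nlinarith [Real.sin_sq_add_cos_sq α]
  refine hcurve ⟨hα4, hα.2⟩ ⟨hβ.1, hβ4⟩ ?_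
  rw [Real.sin_sub]
  linarith

/-- Two functions that agree off a finite set and are continuous from a common side at a point
agree there. -/
theorem ContinuousFromCommonSide.eq_of_eq_off_finset {p q : ℝ → ℝ} {x : ℝ}
    (hx : x ∈ Icc (0 : ℝ) 1) (h : ContinuousFromCommonSide p q x) {F : Finset ℝ}
    (hF : ∀ y ∈ Icc (0 : ℝ) 1, y ∉ F → p y = q y) : p x = q x := by
  have side : ∀ s : Set ℝ, s ⊆ Icc (0 : ℝ) 1 → (𝓝[s \ {x}] x).NeBot →
      ContinuousWithinAt p s x → ContinuousWithinAt q s x → p x = q x := by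
    intro s hs hne hp hq
    have hev : ∀ᶠ y in 𝓝[s \ {x}] x, p y = q y := by
      have hopen : ((F.erase x : Finset ℝ) : Set ℝ)ᶜ ∈ 𝓝 x :=
        (F.erase x).finite_toSet.isClosed.isOpen_compl.mem_nhds (by simp)
      filter_upwards [self_mem_nhdsWithin, nhdsWithin_le_nhds hopen] with y hy hyF
      refine hF y (hs hy.1) fun hyF' => hyF ?_
      exact Finset.mem_coe.2 (Finset.mem_erase.2 ⟨hy.2, hyF'⟩)
    have hp' := hp.mono_left (nhdsWithin_mono x (sdiff_subset (t := {x})))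
    have hq' := hq.mono_left (nhdsWithin_mono x (sdiff_subset (t := {x})))
    exact tendsto_nhds_unique_of_eventuallyEq hp' hq' hev
  rcases h with ⟨h1, hp, hq⟩ | ⟨h0, hp, hq⟩
  · refine side _ (Icc_subset_Icc_left hx.1) ?_ hp hq
    rw [Icc_sdiff_left, nhdsWithin_Ioc_eq_nhdsGT h1]
    infer_instance
  · refine side _ (Icc_subset_Icc_right hx.2) ?_ hp hq
    rw [Icc_sdiff_right, nhdsWithin_Ico_eq_nhdsLT h0]
    infer_instance

end VibratingString

theorem theorem2p1 (p q : ℝ → ℝ) (α β l m : ℝ)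
    (hp : VibratingString.IsDensity p) (hq : VibratingString.IsDensity q)
    (hα : α ∈ Set.Ioc 0 Real.pi) (hβ : β ∈ Set.Ico 0 Real.pi)
    (hcurve : α ∈ Set.Icc (Real.pi / 4) Real.pi → β ∈ Set.Icc 0 (3 * Real.pi / 4) →
      Real.cos α * Real.cos β - Real.sin (α - β) ≠ 0)
    (hl : VibratingString.IsLowestEigenvalue p α β l)
    (hm : VibratingString.IsLowestEigenvalue q α β m)
    (h : (∃ M : ℝ, IsLUB ((fun x => q x / p x) '' Set.Icc 0 1) M ∧ l = m * M) ∨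
      (∃ M : ℝ, IsGLB ((fun x => q x / p x) '' Set.Icc 0 1) M ∧ l = m * M)) :
    {x ∈ Set.Icc (0 : ℝ) 1 | p x ≠ m / l * q x}.Finite ∧
    ∀ x ∈ Set.Icc (0 : ℝ) 1, VibratingString.ContinuousFromCommonSide p q x →
      p x = m / l * q x := by
  have hl0 : l ≠ 0 := hl.ne_zero hp hα hβ hcurve
  obtain ⟨U, V, hU⟩ := hp.piecewiseContinuous.exists_isShootingFamily α
  obtain ⟨A, B, hA⟩ := hq.piecewiseContinuous.exists_isShootingFamily α
  have hppos : ∀ x ∈ Icc (0 : ℝ) 1, 0 < p x := by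
    obtain ⟨c, hc, hpc⟩ := hp.boundedAway
    exact fun x hx => hc.trans_le (hpc x hx)
  have hord : (∀ x ∈ Icc (0 : ℝ) 1, m * q x ≤ l * p x) ∨
      (∀ x ∈ Icc (0 : ℝ) 1, l * p x ≤ m * q x) := by
    have scale : ∀ M : ℝ, l = m * M →
        ((∀ x ∈ Icc (0 : ℝ) 1, q x ≤ M * p x) ∨ (∀ x ∈ Icc (0 : ℝ) 1, M * p x ≤ q x)) →
        (∀ x ∈ Icc (0 : ℝ) 1, m * q x ≤ l * p x) ∨
          (∀ x ∈ Icc (0 : ℝ) 1, l * p x ≤ m * q x) := by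
      rintro M rfl hM
      simp only [mul_assoc]
      rcases hM with hM | hM <;> rcases le_total 0 m with hm0 | hm0
      · exact Or.inl fun x hx => mul_le_mul_of_nonneg_left (hM x hx) hm0
      · exact Or.inr fun x hx => mul_le_mul_of_nonpos_left (hM x hx) hm0
      · exact Or.inr fun x hx => mul_le_mul_of_nonneg_left (hM x hx) hm0
      · exact Or.inl fun x hx => mul_le_mul_of_nonpos_left (hM x hx) hm0
    rcases h with ⟨M, hM, e⟩ | ⟨M, hM, e⟩
    · exact scale M e (Or.inl fun x hx => (div_le_iff₀ (hppos x hx)).1 (hM.1 ⟨x, hx, rfl⟩))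
    · exact scale M e (Or.inr fun x hx => (le_div_iff₀ (hppos x hx)).1 (hM.1 ⟨x, hx, rfl⟩))
  have eU := (hU.isEigenvalue_iff hp.piecewiseContinuous l).1 hl.1
  have eA := (hA.isEigenvalue_iff hq.piecewiseContinuous m).1 hm.1
  have h1 : U l 1 * B m 1 - V l 1 * A m 1 = 0 := by
    have hc : (U l 1 * B m 1 - V l 1 * A m 1) * Real.cos β = 0 := by
      linear_combination B m 1 * eU - V l 1 * eA
    have hs : (U l 1 * B m 1 - V l 1 * A m 1) * Real.sin β = 0 := by
      linear_combination U l 1 * eA - A m 1 * eU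
    linear_combination Real.cos β * hc + Real.sin β * hs -
      (U l 1 * B m 1 - V l 1 * A m 1) * Real.sin_sq_add_cos_sq β
  obtain ⟨F, hF⟩ := (hU.sol l).coeff_eq_off_finset (hA.sol m)
    (hU.pos_of_isLowestEigenvalue hp hα hβ hl) (hA.pos_of_isLowestEigenvalue hq hα hβ hm)
    (by rw [hU.left, hU.left_deriv, hA.left, hA.left_deriv]; ring) h1 hord
  have hF' : ∀ x ∈ Icc (0 : ℝ) 1, x ∉ F → p x = m / l * q x := by
    intro x hx hxF
    have := hF x hx hxF
    field_simp
    linarith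
  refine ⟨F.finite_toSet.subset fun x hx => ?_, fun x hx hside => ?_⟩
  · by_contra hxF
    exact hx.2 (hF' x hx.1 hxF)
  · have hside' : VibratingString.ContinuousFromCommonSide p (fun y => m / l * q y) x := by
      rcases hside with ⟨h0, hc, hd⟩ | ⟨h0, hc, hd⟩
      · exact Or.inl ⟨h0, hc, hd.const_mul _⟩
      · exact Or.inr ⟨h0, hc, hd.const_mul _⟩
    exact hside'.eq_of_eq_off_finset hx hF'
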